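/- **Model.** Fix constants $\lambda_{\rm U},R_{\rm B},\alpha_{\rm L},G_{\rm A},g_{\rm A},G_{\rm U},g_{\rm U},B,\rho_0>0$ and $\theta_{\rm A},\theta_{\rm U}\in(0,2\pi]$. For a relative density $\psi>0$ and a spatial multiplexing gain $k\ge 1$ with $k\theta_{\rm A}\le 2\pi$, the access points form a homogeneous Poisson point process $\Phi_{\rm A}$ in $\mathbb R^2$ of intensity $\lambda_{\rm A}=\psi/(\pi R_{\rm B}^2)$. Each $x\in\Phi_{\rm A}$ carries two gains $\mathbb G_{{\rm A},x},\mathbb G_{{\rm U},x}$, where all the gains are independent of each other and of $\Phi_{\rm A}$, $\mathbb P(\mathbb G_{{\rm A},x}=G_{\rm A})=\frac{k\theta_{\rm A}}{2\pi}=1-\mathbb P(\mathbb G_{{\rm A},x}=g_{\rm A})$ and $\mathbb P(\mathbb G_{{\rm U},x}=G_{\rm U})=\frac{\theta_{\rm U}}{2\pi}=1-\mathbb P(\mathbb G_{{\rm U},x}=g_{\rm U})$ (if the two values coincide, the gain is that constant). Let $\ell(r)^{-1}=r^{-\alpha_{\rm L}}$ for $r\le R_{\rm B}$ and $\ell(r)^{-1}=0$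 for $r>R_{\rm B}$. The end-user at the origin is served by $x_0=\arg\max_{x\in\Phi_{\rm A}}\ell(|x|)^{-1}$, and $$\mathrm{SINR}=\frac{G_{\rm A}G_{\rm U}\,\ell(|x_0|)^{-1}}{\sum_{x\in\Phi_{\rm A}\setminus\{x_0\}}\mathbb G_{{\rm A},x}\mathbb G_{{\rm U},x}\,\ell(|x|)^{-1}},\qquad \mathcal C_\psi(\tau,k)=\mathbb P(\mathrm{SINR}>\tau),$$ where $\mathrm{SINR}=+\infty$ if the numerator is positive and the denominator vanishes, and $\mathrm{SINR}=0$ if the numerator vanishes. **Load.** The bandwidth of the end-user at the origin is $B/\Psi$, where $\Psi\ge1$ is integer-valued and independent of the SINR, with either of the following two laws: (i) given $\mathcal A'$, $\Psi-1$ is Poisson with mean $\lambda_{\rm U}\mathcal A'$, where $\mathcal A'$ has density proportional to $y^{3.5}e^{-3.5k\lambda_{\rm A}y}$ on $0<y\le\pi R_{\rm B}^2/k$; (ii) the simplified law $$\mathbb P(\Psi=n)=\frac{3.5^{3.5}\,\Gamma(n+3.5)}{(n-1)!\,\Gamma(3.5)}\Big(\frac{\pi R_{\rm B}^2\lambda_{\rm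 U}}{k\psi}\Big)^{n-1}\Big(3.5+\frac{\pi R_{\rm B}^2\lambda_{\rm U}}{k\psi}\Big)^{-n-3.5},\qquad n\ge1.$$ **Throughput and densification gain.** The throughput of the fixed-rate coding scheme with rate threshold $\rho$ is $$\mathcal T(\rho;\psi,k)=\lambda_{\rm U}\,\rho\,\mathbb P\Big(\tfrac B\Psi\log_2(1+\mathrm{SINR})>\rho\Big)=\lambda_{\rm U}\,\rho\,\mathbb E_\Psi\big[\mathcal C_\psi(2^{\rho\Psi/B}-1,k)\big],$$ and the densification gain is $\gamma(\psi,k)=\mathcal T(\psi\rho_0;\psi,k)/\mathcal T(\rho_0;1,k)$. **Lemma.** For $k=1$ and for each of the two laws of $\Psi$, $\mathcal T(\rho_0;1,1)>0$, and the densification gain is bounded by a finite constant as $\psi\to\infty$: there is a constant $a<\infty$ such that $\gamma(\psi,1)\le a$ for all sufficiently large $\psi$. -/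

import Mathlib

open MeasureTheory ProbabilityTheory Filter
open scoped ENNReal Nat

noncomputable section

namespace MmWave

/-- The Euclidean plane. -/
abbrev Plane : Type := EuclideanSpace ℝ (Fin 2)

/-- The number (with multiplicity) of points of the sequence `X` that lie in `s`. -/
def pointCount {Ω E : Type*} (X : ℕ → Ω → E) (s : Set E) (ω : Ω) : ℕ∞ :=
  {i : ℕ | X i ω ∈ s}.encard

/-- The random points `X 0, X 1, …` enumerate a Poisson point process with intensity measure `ν`
(of infinite total mass): counts are Poisson, and counts in disjoint sets are independent. -/
structure IsPoissonPointProcess {Ω E : Type*} [MeasurableSpace Ω] [MeasurableSpace E]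
    (P : Measure Ω) (X : ℕ → Ω → E) (ν : Measure E) : Prop where
  measurable : ∀ i, Measurable (X i)
  poisson : ∀ s : Set E, MeasurableSet s → ν s ≠ ∞ → ∀ n : ℕ,
    P {ω | pointCount X s ω = n} = poissonMeasure (ν s).toNNReal {n}
  indep : ∀ (m : ℕ) (s : Fin m → Set E), (∀ j, MeasurableSet (s j)) →
    Pairwise (fun i j => Disjoint (s i) (s j)) → iIndepFun (fun j => pointCount X (s j)) P

/-- The constant system parameters of the network. -/
structure Params where
  /-- intensity of the end-users -/
  lamU : ℝ
  /-- radius of the line-of-sight ball -/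
  RB : ℝ
  /-- line-of-sight path loss exponent -/
  alpha : ℝ
  /-- main lobe gain of an access point -/
  mainA : ℝ
  /-- side lobe gain of an access point -/
  sideA : ℝ
  /-- main lobe gain of an end-user -/
  mainU : ℝ
  /-- side lobe gain of an end-user -/
  sideU : ℝ
  /-- main lobe width of an access point -/
  thetaA : ℝ
  /-- main lobe width of an end-user -/
  thetaU : ℝ
  /-- total bandwidth available at an access point -/
  B : ℝ
  lamU_pos : 0 < lamU
  RB_pos : 0 < RB
  alpha_pos : 0 < alpha
  mainA_pos : 0 < mainA
  sideA_pos : 0 < sideA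
  mainU_pos : 0 < mainU
  sideU_pos : 0 < sideU
  thetaA_pos : 0 < thetaA
  thetaA_le : thetaA ≤ 2 * Real.pi
  thetaU_pos : 0 < thetaU
  thetaU_le : thetaU ≤ 2 * Real.pi
  B_pos : 0 < B

/-- The intensity `λ_A` of the access points at relative density `ψ`, i.e. `ψ = π λ_A R_B ^ 2`. -/
def Params.lamA (net : Params) (ψ : ℝ) : ℝ := ψ / (Real.pi * net.RB ^ 2)

/-- The inverse path loss `ℓ(r)⁻¹` of the line-of-sight ball model. -/
def Params.invPathLoss (net : Params) (r : ℝ) : ℝ :=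
  if r ≤ net.RB then r ^ (-net.alpha) else 0

/-- The law that gives mass `p` to `a` and mass `1 - p` to `b`. -/
def twoPointLaw (p a b : ℝ) : Measure ℝ :=
  ENNReal.ofReal p • Measure.dirac a + ENNReal.ofReal (1 - p) • Measure.dirac b

/-- The positions of the access points, as seen from the typical end-user at the origin, with the
hybrid precoding gains of the (unintended) link from each access point to that end-user. -/
structure Deployment (Ω : Type*) where
  pos : ℕ → Ω → Plane
  gainA : ℕ → Ω → ℝ
  gainU : ℕ → Ω → ℝ

/-- The deployment has relative density `ψ` and spatial multiplexing gain `k`: the access points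
form a homogeneous Poisson point process of intensity `λ_A`, independently marked with independent
two-valued gains. -/
structure Deployment.IsNetwork {Ω : Type*} [MeasurableSpace Ω] (N : Deployment Ω)
    (net : Params) (ψ : ℝ) (k : ℕ) (P : Measure Ω) : Prop where
  poisson : IsPoissonPointProcess P N.pos (ENNReal.ofReal (net.lamA ψ) • (volume : Measure Plane))
  measurable_gainA : ∀ i, Measurable (N.gainA i)
  measurable_gainU : ∀ i, Measurable (N.gainU i)
  law_gainA : ∀ i, P.map (N.gainA i) =
    twoPointLaw (k * net.thetaA / (2 * Real.pi)) net.mainA net.sideA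
  law_gainU : ∀ i, P.map (N.gainU i) =
    twoPointLaw (net.thetaU / (2 * Real.pi)) net.mainU net.sideU
  indep_gains : ∀ i, IndepFun (N.gainA i) (N.gainU i) P
  iIndep_marks : iIndepFun (fun i ω => (N.gainA i ω, N.gainU i ω)) P
  indep_pos_marks : IndepFun (fun ω i => N.pos i ω) (fun ω i => (N.gainA i ω, N.gainU i ω)) P

/-- The index of the access point `x₀` that serves the origin: an index maximizing
`ℓ(|x|)⁻¹` (the least one; almost surely a maximizer exists). -/
def Deployment.server {Ω : Type*} (N : Deployment Ω) (net : Params) (ω : Ω) : ℕ :=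
  sInf {i : ℕ | ∀ j, net.invPathLoss ‖N.pos j ω‖ ≤ net.invPathLoss ‖N.pos i ω‖}

/-- The received power from the aligned serving access point. -/
def Deployment.signal {Ω : Type*} (N : Deployment Ω) (net : Params) (ω : Ω) : ℝ≥0∞ :=
  ENNReal.ofReal (net.mainA * net.mainU * net.invPathLoss ‖N.pos (N.server net ω) ω‖)

/-- The received power from all the other access points. -/
def Deployment.interference {Ω : Type*} (N : Deployment Ω) (net : Params) (ω : Ω) : ℝ≥0∞ :=
  ∑' i : ℕ, if i = N.server net ω then 0 else
    ENNReal.ofReal (N.gainA i ω * N.gainU i ω * net.invPathLoss ‖N.pos i ω‖)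

/-- The SINR at the origin, thermal noise being ignored. It is `∞` if there is a signal and no
interference, and `0` if there is no signal. -/
def Deployment.sinr {Ω : Type*} (N : Deployment Ω) (net : Params) (ω : Ω) : ℝ≥0∞ :=
  N.signal net ω / N.interference net ω

/-- The coverage probability `𝒞_ψ(τ, k) = ℙ(SINR > τ)`. -/
def Deployment.coverage {Ω : Type*} [MeasurableSpace Ω] (N : Deployment Ω) (net : Params)
    (P : Measure Ω) (τ : ℝ) : ℝ :=
  P.real {ω | ENNReal.ofReal τ < N.sinr net ω}

/-- The unnormalized density of the area of the sector that contains the typical end-user,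
on `0 < y ≤ π R_B ^ 2 / k`. -/
def Params.areaDensity (net : Params) (ψ : ℝ) (k : ℕ) (y : ℝ) : ℝ :=
  y ^ (3.5 : ℝ) * Real.exp (-3.5 * k * net.lamA ψ * y)

/-- `ℙ(Ψ = n)` for the number `Ψ` of end-users that share the resources with the one at the origin:
given the sector area `y`, `Ψ - 1` is Poisson with mean `λ_U y`. -/
def loadPMF (net : Params) (ψ : ℝ) (k n : ℕ) : ℝ :=
  if n = 0 then 0 else
    (∫ y in (0 : ℝ)..(Real.pi * net.RB ^ 2 / k),
        Real.exp (-(net.lamU * y)) * (net.lamU * y) ^ (n - 1) / ((n - 1)! : ℝ) *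
          net.areaDensity ψ k y) /
      ∫ y in (0 : ℝ)..(Real.pi * net.RB ^ 2 / k), net.areaDensity ψ k y

/-- The simplified form of `ℙ(Ψ = n)`, in which the sector area is not truncated. -/
def simplifiedLoadPMF (net : Params) (ψ : ℝ) (k n : ℕ) : ℝ :=
  if n = 0 then 0 else
    (3.5 : ℝ) ^ (3.5 : ℝ) * Real.Gamma (n + 3.5) / (((n - 1)! : ℝ) * Real.Gamma 3.5) *
      (Real.pi * net.RB ^ 2 * net.lamU / (k * ψ)) ^ (n - 1) *
      (3.5 + Real.pi * net.RB ^ 2 * net.lamU / (k * ψ)) ^ (-(n : ℝ) - 3.5)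

/-- The throughput `λ_U ρ 𝔼_Ψ[𝒞_ψ(2 ^ (ρ Ψ / B) - 1, k)]` of the fixed-rate coding scheme with rate
threshold `ρ`, where `load n = ℙ(Ψ = n)`. -/
def Deployment.throughput {Ω : Type*} [MeasurableSpace Ω] (N : Deployment Ω) (net : Params)
    (P : Measure Ω) (load : ℕ → ℝ) (ρ : ℝ) : ℝ :=
  net.lamU * ρ * ∑' n : ℕ, load n * N.coverage net P ((2 : ℝ) ^ (ρ * n / net.B) - 1)

/-- The densification gain `γ(ψ, k) = 𝒯(ψ ρ₀; ψ, k) / 𝒯(ρ₀; 1, k)`, where `N ψ` is the network of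
relative density `ψ` and `load ψ k` is the law of `Ψ`. -/
def densificationGain {Ω : ℝ → Type*} [∀ ψ, MeasurableSpace (Ω ψ)] (net : Params)
    (P : ∀ ψ, Measure (Ω ψ)) (N : ∀ ψ, Deployment (Ω ψ)) (load : ℝ → ℕ → ℕ → ℝ)
    (ρ₀ ψ : ℝ) (k : ℕ) : ℝ :=
  (N ψ).throughput net (P ψ) (load ψ k) (ψ * ρ₀) / (N 1).throughput net (P 1) (load 1 k) ρ₀

end MmWave

end

/-! Densification raises the rate threshold linearly in `ψ`, hence the SINR threshold `τ = 2 ^ (ψ ρ₀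
/ B) - 1` exponentially. If two access points lie in the line-of-sight ball, the interference is at
least a fixed constant: the smallest gains times the path loss at the edge. SINR above `τ` then
forces the server into a disc of radius of order `τ ^ (-1/α)`, which is exponentially small. Hence
coverage is at most the probability of at most one visible point plus that of a nonempty disc
(`IsNetwork.coverage_le`). Even multiplied by `ψ`, this tends to `0` (`tendsto_mul_coverage_bound`).

Since `Ψ ≥ 1`, averaging over the load costs at most the total mass of its law, so only a bound on
that mass uniform in `ψ ≥ 1` is needed (`IsBoundedLoad`). Positivity at `ψ = 1` comes from the event
of exactly one visible access point, where the SINR is infinite. -/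

namespace MmWave

/-! ### Poisson counts -/

section PointProcess

variable {Ω E : Type*} [MeasurableSpace Ω] [MeasurableSpace E] {P : Measure Ω} {X : ℕ → Ω → E}
  {ν : Measure E}

theorem IsPoissonPointProcess.measureReal_pointCount_eq (h : IsPoissonPointProcess P X ν)
    {s : Set E} (hs : MeasurableSet s) {x : ℝ} (hx : 0 ≤ x) (hν : ν s = ENNReal.ofReal x) (n : ℕ) :
    P.real {ω | pointCount X s ω = n} = Real.exp (-x) * x ^ n / (n ! : ℝ) := by
  have := h.poisson s hs (by simp [hν]) n
  rw [measureReal_def, this, ← measureReal_def, poissonMeasure_real_singleton, hν]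
  have : ((ENNReal.ofReal x).toNNReal : ℝ) = x := ENNReal.toReal_ofReal hx
  rw [this]

/-- From `1 - exp (-x) ≤ x`; applied to the small disc that must contain the server. -/
theorem IsPoissonPointProcess.measureReal_pointCount_ne_zero_le [IsProbabilityMeasure P]
    (h : IsPoissonPointProcess P X ν) {s : Set E} (hs : MeasurableSet s) {x : ℝ} (hx : 0 ≤ x)
    (hν : ν s = ENNReal.ofReal x) :
    P.real {ω | pointCount X s ω ≠ 0} ≤ x := by
  have h0 := h.measureReal_pointCount_eq hs hx hν 0
  have hm : MeasurableSet {ω | pointCount X s ω = (0 : ℕ)} := by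
    have : {ω | pointCount X s ω = (0 : ℕ)} = ⋂ i, (X i ⁻¹' s)ᶜ := by
      ext ω
      simp [pointCount, Set.eq_empty_iff_forall_notMem]
    rw [this]
    exact MeasurableSet.iInter fun i => (h.measurable i hs).compl
  have hc := probReal_compl_eq_one_sub (μ := P) hm
  have hset : {ω | pointCount X s ω ≠ 0} = {ω | pointCount X s ω = (0 : ℕ)}ᶜ := by
    ext ω; simp
  rw [hset, hc, h0]
  have := Real.add_one_le_exp (-x)
  simp
  linarith

theorem IsPoissonPointProcess.measureReal_pointCount_le_one_le [IsProbabilityMeasure P]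
    (h : IsPoissonPointProcess P X ν) {s : Set E} (hs : MeasurableSet s) {x : ℝ} (hx : 0 ≤ x)
    (hν : ν s = ENNReal.ofReal x) :
    P.real {ω | pointCount X s ω ≤ 1} ≤ (1 + x) * Real.exp (-x) := by
  have h0 := h.measureReal_pointCount_eq hs hx hν 0
  have h1 := h.measureReal_pointCount_eq hs hx hν 1
  have hset : {ω | pointCount X s ω ≤ 1} ⊆
      {ω | pointCount X s ω = (0 : ℕ)} ∪ {ω | pointCount X s ω = (1 : ℕ)} := by
    intro ω hω
    rcases eq_or_lt_of_le (show pointCount X s ω ≤ 1 from hω) with h | h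
    · right; simpa using h
    · left; simpa using Order.lt_one_iff.1 h
  refine (measureReal_mono hset).trans ((measureReal_union_le _ _).trans ?_)
  rw [h0, h1]
  simp
  linarith

end PointProcess

/-! ### Gains, path loss and intensities -/

theorem ae_eq_or_eq_of_map_eq_twoPointLaw {Ω : Type*} [MeasurableSpace Ω] {P : Measure Ω}
    {X : Ω → ℝ} (hX : Measurable X) {p a b : ℝ} (h : P.map X = twoPointLaw p a b) :
    ∀ᵐ ω ∂P, X ω = a ∨ X ω = b := by
  refine ae_of_ae_map (p := fun x => x = a ∨ x = b) hX.aemeasurable ?_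
  rw [h, twoPointLaw, ae_add_measure_iff]
  constructor <;> refine Measure.ae_smul_measure ?_ _ <;> simp [ae_dirac_eq]

/-- The points of the plane from which a positive power is received at the origin. -/
def Params.visible (net : Params) : Set Plane := Metric.closedBall 0 net.RB \ {0}

theorem Params.invPathLoss_eq_zero_of_notMem (net : Params) {x : Plane} (hx : x ∉ net.visible) :
    net.invPathLoss ‖x‖ = 0 := by
  unfold invPathLoss
  split_ifs with h
  · have : x = 0 := by
      by_contra h0
      exact hx ⟨by simpa using h, h0⟩
    -- The convention `0 ^ (-α) = 0` makes a point at the origin contribute no power, which is why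
    -- `visible` omits it.
    simp [this, Real.zero_rpow (neg_ne_zero.2 net.alpha_pos.ne')]
  · rfl

theorem Params.invPathLoss_of_mem (net : Params) {x : Plane} (hx : x ∈ net.visible) :
    net.invPathLoss ‖x‖ = ‖x‖ ^ (-net.alpha) :=
  if_pos (by simpa using hx.1)

theorem Params.norm_pos_of_mem (net : Params) {x : Plane} (hx : x ∈ net.visible) : 0 < ‖x‖ :=
  norm_pos_iff.2 hx.2

theorem Params.invPathLoss_pos_of_mem (net : Params) {x : Plane} (hx : x ∈ net.visible) :
    0 < net.invPathLoss ‖x‖ := by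
  rw [net.invPathLoss_of_mem hx]
  exact Real.rpow_pos_of_pos (net.norm_pos_of_mem hx) _

theorem Params.le_invPathLoss_of_mem (net : Params) {x : Plane} (hx : x ∈ net.visible) :
    net.RB ^ (-net.alpha) ≤ net.invPathLoss ‖x‖ := by
  rw [net.invPathLoss_of_mem hx]
  exact Real.rpow_le_rpow_of_nonpos (net.norm_pos_of_mem hx) (by simpa using hx.1)
    (by linarith [net.alpha_pos])

theorem Params.norm_lt_of_lt_invPathLoss (net : Params) {x : Plane} {m : ℝ} (hm : 0 < m)
    (h : m < net.invPathLoss ‖x‖) : ‖x‖ < m ^ (-net.alpha⁻¹) := by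
  have hx : x ∈ net.visible := by
    by_contra hx
    rw [net.invPathLoss_eq_zero_of_notMem hx] at h
    linarith
  rw [net.invPathLoss_of_mem hx] at h
  have h2 := Real.rpow_lt_rpow_of_neg hm h (z := -net.alpha⁻¹)
    (by have := inv_pos.2 net.alpha_pos; linarith)
  rwa [← Real.rpow_mul (norm_nonneg _), neg_mul_neg, mul_inv_cancel₀ net.alpha_pos.ne',
    Real.rpow_one] at h2

theorem Params.measurableSet_visible (net : Params) : MeasurableSet net.visible :=
  Metric.isClosed_closedBall.measurableSet.diff (measurableSet_singleton _)

theorem Params.intensity_visible (net : Params) {ψ : ℝ} (hψ : 0 < ψ) :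
    (ENNReal.ofReal (net.lamA ψ) • (volume : Measure Plane)) net.visible = ENNReal.ofReal ψ := by
  have hR := net.RB_pos
  have hpi := Real.pi_pos
  rw [visible, measure_sdiff_null (by simp), Measure.smul_apply,
    EuclideanSpace.volume_closedBall_fin_two, smul_eq_mul, ← ENNReal.ofReal_pow hR.le,
    ← ENNReal.ofReal_mul (by positivity), ← ENNReal.ofReal_mul (by unfold lamA; positivity)]
  congr 1
  unfold lamA
  field_simp

theorem Params.intensity_ball (net : Params) {ψ : ℝ} (hψ : 0 < ψ) {r : ℝ} (hr : 0 ≤ r) :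
    (ENNReal.ofReal (net.lamA ψ) • (volume : Measure Plane)) (Metric.ball 0 r) =
      ENNReal.ofReal (ψ * (r / net.RB) ^ 2) := by
  have hR := net.RB_pos
  have hpi := Real.pi_pos
  rw [Measure.smul_apply, EuclideanSpace.volume_ball_fin_two, smul_eq_mul,
    ← ENNReal.ofReal_pow hr, ← ENNReal.ofReal_mul (by positivity),
    ← ENNReal.ofReal_mul (by unfold lamA; positivity)]
  congr 1
  unfold lamA
  field_simp

/-- The least possible ratio, per unit of SINR, between the interference from another visible
access point and the aligned gain of the server. -/
noncomputable def Params.interferenceRatio (net : Params) : ℝ :=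
  min net.mainA net.sideA * min net.mainU net.sideU * net.RB ^ (-net.alpha) /
    (net.mainA * net.mainU)

theorem Params.interferenceRatio_pos (net : Params) : 0 < net.interferenceRatio := by
  have := lt_min net.mainA_pos net.sideA_pos
  have := lt_min net.mainU_pos net.sideU_pos
  have := Real.rpow_pos_of_pos net.RB_pos (-net.alpha)
  have := net.mainA_pos
  have := net.mainU_pos
  unfold interferenceRatio
  positivity

/-! ### SINR, coverage and throughput -/

namespace Deployment

variable {Ω : Type*} {N : Deployment Ω} {net : Params}

theorem sinr_eq_top_of_pointCount_eq_one {ω : Ω} (h : pointCount N.pos net.visible ω = 1) :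
    N.sinr net ω = ∞ := by
  obtain ⟨i, hi⟩ := Set.encard_eq_one.1 h
  have hmem : N.pos i ω ∈ net.visible := by
    have : i ∈ {i | N.pos i ω ∈ net.visible} := by rw [hi]; rfl
    exact this
  have hpos := net.invPathLoss_pos_of_mem hmem
  have hzero : ∀ j, j ≠ i → net.invPathLoss ‖N.pos j ω‖ = 0 := by
    intro j hj
    refine net.invPathLoss_eq_zero_of_notMem fun hjm => hj ?_
    have : j ∈ {i | N.pos i ω ∈ net.visible} := hjm
    rwa [hi] at this
  have hserver : N.server net ω = i := by
    have : {i : ℕ | ∀ j, net.invPathLoss ‖N.pos j ω‖ ≤ net.invPathLoss ‖N.pos i ω‖} = {i} := by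
      ext l
      simp only [Set.mem_ofPred_eq, Set.mem_singleton_iff]
      constructor
      · intro hl
        by_contra hli
        have := hl i
        rw [hzero l hli] at this
        linarith
      · rintro rfl j
        by_cases hj : j = l
        · rw [hj]
        · rw [hzero j hj]; exact hpos.le
    rw [server, this, csInf_singleton]
  have hint : N.interference net ω = 0 := by
    rw [interference, ENNReal.tsum_eq_zero]
    intro j
    split_ifs with hj
    · rfl
    · rw [hzero j (by rwa [hserver] at hj)]; simp
  have hsig : N.signal net ω ≠ 0 := by
    rw [signal, hserver]
    have := net.mainA_pos
    have := net.mainU_pos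
    exact (ENNReal.ofReal_pos.2 (by positivity)).ne'
  rw [sinr, hint, ENNReal.div_zero hsig]

/-- A second visible point bounds the interference below by a constant, so a large SINR can only
come from a server very close to the origin. -/
theorem pointCount_visible_le_one_or_pointCount_ball_ne_zero {τ : ℝ} (hτ : 0 < τ) {ω : Ω}
    (hA : ∀ i, N.gainA i ω = net.mainA ∨ N.gainA i ω = net.sideA)
    (hU : ∀ i, N.gainU i ω = net.mainU ∨ N.gainU i ω = net.sideU)
    (h : ENNReal.ofReal τ < N.sinr net ω) :
    pointCount N.pos net.visible ω ≤ 1 ∨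
      pointCount N.pos (Metric.ball 0 ((τ * net.interferenceRatio) ^ (-net.alpha⁻¹))) ω ≠ 0 := by
  by_contra! hcon
  obtain ⟨hcount, hball⟩ := hcon
  have hgA := lt_min net.mainA_pos net.sideA_pos
  have hgU := lt_min net.mainU_pos net.sideU_pos
  have hR := Real.rpow_pos_of_pos net.RB_pos (-net.alpha)
  have hmA := net.mainA_pos
  have hmU := net.mainU_pos
  -- Two visible indices always include one other than the server. Maximality of the server is not
  -- needed, so the default value of `sInf` on an empty set does no harm.
  obtain ⟨j, hj, hjs⟩ :=
    (Set.one_lt_encard_iff_nontrivial.1 hcount).exists_ne (N.server net ω)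
  have hi : ENNReal.ofReal
      (min net.mainA net.sideA * min net.mainU net.sideU * net.RB ^ (-net.alpha)) ≤
      N.interference net ω := by
    refine le_trans ?_ (ENNReal.le_tsum j)
    rw [if_neg hjs]
    have h1 : min net.mainA net.sideA ≤ N.gainA j ω := by
      rcases hA j with h | h <;> simp [h]
    have h2 : min net.mainU net.sideU ≤ N.gainU j ω := by
      rcases hU j with h | h <;> simp [h]
    have h3 := net.le_invPathLoss_of_mem hj
    have h4 := hgA.trans_le h1
    have h5 := hgU.trans_le h2
    gcongr
  have hS : N.sinr net ω ≤ ENNReal.ofReal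
      (net.mainA * net.mainU * net.invPathLoss ‖N.pos (N.server net ω) ω‖ /
        (min net.mainA net.sideA * min net.mainU net.sideU * net.RB ^ (-net.alpha))) := by
    rw [ENNReal.ofReal_div_of_pos (by positivity)]
    exact ENNReal.div_le_div_left hi _
  have hlt := (ENNReal.ofReal_lt_ofReal_iff_of_nonneg hτ.le).1 (h.trans_le hS)
  have hlt' : τ * net.interferenceRatio < net.invPathLoss ‖N.pos (N.server net ω) ω‖ := by
    rw [lt_div_iff₀ (by positivity)] at hlt
    rw [Params.interferenceRatio, mul_div_assoc', div_lt_iff₀ (by positivity)]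
    linarith
  have hnorm := net.norm_lt_of_lt_invPathLoss (mul_pos hτ net.interferenceRatio_pos) hlt'
  have : N.server net ω ∈ {i | N.pos i ω ∈
      Metric.ball 0 ((τ * net.interferenceRatio) ^ (-net.alpha⁻¹))} := by
    simpa using hnorm
  rw [Set.encard_eq_zero.1 hball] at this
  exact this

variable [MeasurableSpace Ω] {P : Measure Ω} {ψ : ℝ} {k : ℕ}

theorem coverage_nonneg (τ : ℝ) : 0 ≤ N.coverage net P τ := measureReal_nonneg

variable [IsProbabilityMeasure P]

theorem coverage_le_one (τ : ℝ) : N.coverage net P τ ≤ 1 := measureReal_le_one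

theorem coverage_antitone : Antitone (N.coverage net P) := fun _ _ h =>
  measureReal_mono fun _ hω => (ENNReal.ofReal_le_ofReal h).trans_lt hω

theorem IsNetwork.coverage_pos (h : N.IsNetwork net ψ k P) (hψ : 0 < ψ) (τ : ℝ) :
    0 < N.coverage net P τ := by
  have h1 := h.poisson.measureReal_pointCount_eq net.measurableSet_visible hψ.le
    (net.intensity_visible hψ) 1
  have h2 : 0 < P.real {ω | pointCount N.pos net.visible ω = (1 : ℕ)} := by
    rw [h1]; positivity
  refine h2.trans_le (measureReal_mono fun ω hω => ?_)
  have := sinr_eq_top_of_pointCount_eq_one (N := N) (net := net) (ω := ω) (by simpa using hω)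
  simp [this]

theorem IsNetwork.coverage_le (h : N.IsNetwork net ψ k P) (hψ : 0 < ψ) {τ : ℝ} (hτ : 0 < τ) :
    N.coverage net P τ ≤ (1 + ψ) * Real.exp (-ψ) +
      ψ * ((τ * net.interferenceRatio) ^ (-net.alpha⁻¹) / net.RB) ^ 2 := by
  have hr : 0 ≤ (τ * net.interferenceRatio) ^ (-net.alpha⁻¹) :=
    Real.rpow_nonneg (mul_pos hτ net.interferenceRatio_pos).le _
  have h1 := h.poisson.measureReal_pointCount_le_one_le net.measurableSet_visible hψ.le
    (net.intensity_visible hψ)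
  have h2 := h.poisson.measureReal_pointCount_ne_zero_le Metric.isOpen_ball.measurableSet
    (by positivity) (net.intensity_ball hψ hr)
  have hA := ae_all_iff.2 fun i =>
    ae_eq_or_eq_of_map_eq_twoPointLaw (h.measurable_gainA i) (h.law_gainA i)
  have hU := ae_all_iff.2 fun i =>
    ae_eq_or_eq_of_map_eq_twoPointLaw (h.measurable_gainU i) (h.law_gainU i)
  refine le_trans ?_ ((measureReal_union_le _ _).trans (add_le_add h1 h2))
  -- The gains take their two values only almost surely, so the inclusion of events holds only
  -- almost everywhere.
  refine ENNReal.toReal_mono (measure_ne_top _ _) (measure_mono_ae ?_)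
  filter_upwards [hA, hU] with ω hA hU hω
  exact pointCount_visible_le_one_or_pointCount_ball_ne_zero hτ hA hU hω

theorem throughput_pos (h : N.IsNetwork net ψ k P) (hψ : 0 < ψ) {load : ℕ → ℝ}
    (h0 : ∀ n, 0 ≤ load n) (hs : Summable load) (h1 : 0 < load 1) {ρ : ℝ} (hρ : 0 < ρ) :
    0 < N.throughput net P load ρ := by
  have hsum : Summable fun n : ℕ =>
      load n * N.coverage net P ((2 : ℝ) ^ (ρ * n / net.B) - 1) :=
    hs.of_nonneg_of_le (fun n => mul_nonneg (h0 n) (coverage_nonneg _))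
      fun n => mul_le_of_le_one_right (h0 n) (coverage_le_one _)
  refine mul_pos (mul_pos net.lamU_pos hρ) (hsum.tsum_pos
    (fun n => mul_nonneg (h0 n) (coverage_nonneg _)) 1 (mul_pos h1 (h.coverage_pos hψ _)))

/-- For `n ≥ 1` the SINR threshold is at least its value at `n = 1`, and coverage decreases in the
threshold; the term `n = 0` has no weight. -/
theorem throughput_le {load : ℕ → ℝ} (h0 : ∀ n, 0 ≤ load n) (hz : load 0 = 0)
    (hs : Summable load) {ρ : ℝ} (hρ : 0 < ρ) :
    N.throughput net P load ρ ≤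
      net.lamU * ρ * ((∑' n, load n) * N.coverage net P ((2 : ℝ) ^ (ρ / net.B) - 1)) := by
  have hsum : Summable fun n : ℕ =>
      load n * N.coverage net P ((2 : ℝ) ^ (ρ * n / net.B) - 1) :=
    hs.of_nonneg_of_le (fun n => mul_nonneg (h0 n) (coverage_nonneg _))
      fun n => mul_le_of_le_one_right (h0 n) (coverage_le_one _)
  have hB := net.B_pos
  refine mul_le_mul_of_nonneg_left ?_ (mul_pos net.lamU_pos hρ).le
  rw [← tsum_mul_right]
  refine hsum.tsum_le_tsum (fun n => ?_) (hs.mul_right _)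
  rcases Nat.eq_zero_or_pos n with rfl | hn
  · simp [hz]
  · refine mul_le_mul_of_nonneg_left (coverage_antitone ?_) (h0 n)
    have hn' : (1 : ℝ) ≤ n := by exact_mod_cast hn
    have : ρ ≤ ρ * n := le_mul_of_one_le_right hρ.le hn'
    gcongr
    norm_num

end Deployment

/-! ### Decay of the coverage bound -/

theorem tendsto_mul_rpow_neg_two_rpow {a b c : ℝ} (ha : 0 < a) (hb : 0 < b) (hc : 0 < c) :
    Tendsto (fun ψ : ℝ => ψ * (((2 : ℝ) ^ (a * ψ) - 1) * c) ^ (-b)) atTop (nhds 0) := by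
  have hl := Real.log_pos one_lt_two
  have hlim := (tendsto_rpow_mul_exp_neg_mul_atTop_nhds_zero 1 (Real.log 2 * a * b)
    (by positivity)).const_mul ((c / 2) ^ (-b))
  rw [mul_zero] at hlim
  refine squeeze_zero' ?_ ?_ hlim
  · filter_upwards [eventually_gt_atTop 0] with ψ hψ
    have : (1 : ℝ) ≤ 2 ^ (a * ψ) := Real.one_le_rpow one_le_two (by positivity)
    exact mul_nonneg hψ.le (Real.rpow_nonneg (mul_nonneg (by linarith) hc.le) _)
  · filter_upwards [eventually_ge_atTop a⁻¹] with ψ hψ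
    have hψ0 : 0 < ψ := (inv_pos.2 ha).trans_le hψ
    have h1 : 1 ≤ a * ψ := by rwa [inv_le_iff_one_le_mul₀' ha] at hψ
    have h2 : (2 : ℝ) ≤ 2 ^ (a * ψ) := by
      simpa using Real.rpow_le_rpow_of_exponent_le one_le_two h1
    -- Once `a ψ ≥ 1`, subtracting `1` at most halves the power of two.
    have h3 : (2 : ℝ) ^ (a * ψ) * (c / 2) ≤ ((2 : ℝ) ^ (a * ψ) - 1) * c := by nlinarith
    have h4 := Real.rpow_le_rpow_of_nonpos (by positivity) h3 (neg_nonpos.2 hb.le)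
    refine (mul_le_mul_of_nonneg_left h4 hψ0.le).trans (le_of_eq ?_)
    rw [Real.mul_rpow (by positivity) (by positivity), ← Real.rpow_mul zero_le_two,
      Real.rpow_one, Real.rpow_def_of_pos zero_lt_two]
    ring_nf

/-- The outer factor `ψ` is the growth of the rate threshold. It splits between the terms: `ψ e^{-ψ}
+ ψ² e^{-ψ}` plus the square of `ψ` times the relative disc radius. -/
theorem tendsto_mul_coverage_bound (net : Params) {ρ₀ : ℝ} (hρ₀ : 0 < ρ₀) :
    Tendsto (fun ψ : ℝ => ψ * ((1 + ψ) * Real.exp (-ψ) +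
      ψ * ((((2 : ℝ) ^ (ψ * ρ₀ / net.B) - 1) * net.interferenceRatio) ^ (-net.alpha⁻¹) /
        net.RB) ^ 2)) atTop (nhds 0) := by
  have h1 := Real.tendsto_pow_mul_exp_neg_atTop_nhds_zero 1
  have h2 := Real.tendsto_pow_mul_exp_neg_atTop_nhds_zero 2
  have h3 := ((tendsto_mul_rpow_neg_two_rpow (div_pos hρ₀ net.B_pos) (inv_pos.2 net.alpha_pos)
    net.interferenceRatio_pos).div_const net.RB).pow 2
  have := (h1.add h2).add h3
  simp only [zero_div, add_zero, ne_eq, OfNat.ofNat_ne_zero, not_false_eq_true, zero_pow] at this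
  refine this.congr fun ψ => ?_
  rw [show ρ₀ / net.B * ψ = ψ * ρ₀ / net.B by ring]
  ring

/-- `load ψ n` is, for `ψ ≥ 1`, a summable weight on the positive integers, with a total mass
bounded uniformly in `ψ`. -/
structure IsBoundedLoad (load : ℝ → ℕ → ℝ) (K : ℝ) : Prop where
  nonneg : ∀ ψ, 1 ≤ ψ → ∀ n, 0 ≤ load ψ n
  zero : ∀ ψ, 1 ≤ ψ → load ψ 0 = 0
  one_pos : 0 < load 1 1
  summable : ∀ ψ, 1 ≤ ψ → Summable (load ψ)
  tsum_le : ∀ ψ, 1 ≤ ψ → ∑' n, load ψ n ≤ K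

/-! ### Uniform mass bounds for the two load laws -/

section Load

variable (net : Params)

theorem Params.continuous_areaDensity (ψ : ℝ) (k : ℕ) : Continuous (net.areaDensity ψ k) := by
  unfold areaDensity
  exact (Real.continuous_rpow_const (by norm_num)).mul (by fun_prop)

theorem Params.areaDensity_pos (ψ : ℝ) (k : ℕ) {y : ℝ} (hy : 0 < y) :
    0 < net.areaDensity ψ k y :=
  mul_pos (Real.rpow_pos_of_pos hy _) (Real.exp_pos _)

theorem Params.integral_areaDensity_pos (ψ : ℝ) {k : ℕ} (hk : 0 < k) :
    0 < ∫ y in (0 : ℝ)..(Real.pi * net.RB ^ 2 / k), net.areaDensity ψ k y := by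
  have := net.RB_pos
  have := Real.pi_pos
  have : (0 : ℝ) < k := by exact_mod_cast hk
  exact intervalIntegral.intervalIntegral_pos_of_pos_on
    ((net.continuous_areaDensity ψ k).intervalIntegrable _ _)
    (fun y hy => net.areaDensity_pos ψ k hy.1) (by positivity)

theorem loadPMF_pos (ψ : ℝ) {k : ℕ} (hk : 0 < k) (n : ℕ) : 0 < loadPMF net ψ k (n + 1) := by
  have := net.RB_pos
  have := Real.pi_pos
  have : (0 : ℝ) < k := by exact_mod_cast hk
  have hU := net.lamU_pos
  have hc := net.continuous_areaDensity ψ k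
  rw [loadPMF, if_neg (by simp)]
  refine div_pos (intervalIntegral.intervalIntegral_pos_of_pos_on
    (Continuous.intervalIntegrable (by fun_prop) _ _) (fun y hy => ?_) (by positivity))
    (net.integral_areaDensity_pos ψ hk)
  have hy0 : 0 < y := hy.1
  have := net.areaDensity_pos ψ k hy0
  positivity

/-- Under the integral, the partial sums of the Poisson weights are at most `1`. -/
theorem sum_loadPMF_le_one (ψ : ℝ) {k : ℕ} (hk : 0 < k) (m : ℕ) :
    ∑ n ∈ Finset.range m, loadPMF net ψ k (n + 1) ≤ 1 := by
  have := net.RB_pos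
  have := Real.pi_pos
  have : (0 : ℝ) < k := by exact_mod_cast hk
  have hU := net.lamU_pos
  have hc := net.continuous_areaDensity ψ k
  simp only [loadPMF, Nat.succ_ne_zero, if_false, Nat.add_sub_cancel]
  rw [← Finset.sum_div, div_le_one (net.integral_areaDensity_pos ψ hk),
    ← intervalIntegral.integral_finsetSum
      (fun i _ => Continuous.intervalIntegrable (by fun_prop) _ _)]
  refine intervalIntegral.integral_mono_on (by positivity)
    (Continuous.intervalIntegrable (by fun_prop) _ _) (hc.intervalIntegrable _ _) fun y hy => ?_
  rw [← Finset.sum_mul]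
  have hd : 0 ≤ net.areaDensity ψ k y :=
    mul_nonneg (Real.rpow_nonneg hy.1 _) (Real.exp_pos _).le
  refine mul_le_of_le_one_left hd ?_
  simp only [mul_div_assoc]
  rw [← Finset.mul_sum, Real.exp_neg, inv_mul_le_iff₀ (Real.exp_pos _), mul_one]
  exact Real.sum_le_exp_of_nonneg (mul_nonneg hU.le hy.1) m

theorem isBoundedLoad_loadPMF : IsBoundedLoad (fun ψ => loadPMF net ψ 1) 1 := by
  have hz : ∀ ψ, loadPMF net ψ 1 0 = 0 := fun ψ => by simp [loadPMF]
  have hs : ∀ ψ, Summable fun n => loadPMF net ψ 1 (n + 1) := fun ψ =>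
    summable_of_sum_range_le (fun n => (loadPMF_pos net ψ one_pos n).le)
      (sum_loadPMF_le_one net ψ one_pos)
  refine ⟨fun ψ _ n => ?_, fun ψ _ => hz ψ, loadPMF_pos net 1 one_pos 0,
    fun ψ _ => (summable_nat_add_iff 1).1 (hs ψ), fun ψ _ => ?_⟩
  · cases n with
    | zero => exact (hz ψ).ge
    | succ n => exact (loadPMF_pos net ψ one_pos n).le
  · rw [((summable_nat_add_iff 1).1 (hs ψ)).tsum_eq_zero_add, hz, zero_add]
    exact Real.tsum_le_of_sum_range_le (fun n => (loadPMF_pos net ψ one_pos n).le)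
      (sum_loadPMF_le_one net ψ one_pos)

theorem simplifiedLoadPMF_pos {ψ : ℝ} (hψ : 0 < ψ) {k : ℕ} (hk : 0 < k) (n : ℕ) :
    0 < simplifiedLoadPMF net ψ k (n + 1) := by
  have := net.RB_pos
  have := net.lamU_pos
  have := Real.pi_pos
  have : (0 : ℝ) < k := by exact_mod_cast hk
  have := Real.Gamma_pos_of_pos (show (0 : ℝ) < ((n + 1 : ℕ) : ℝ) + 3.5 by positivity)
  have := Real.Gamma_pos_of_pos (show (0 : ℝ) < 3.5 by norm_num)
  rw [simplifiedLoadPMF, if_neg (by simp)]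
  positivity

/-- Rounding `n + 4.5` up to `n + 5` turns the Gamma value into `(n + 4)!`, and the quotient into a
polynomial of degree 4. -/
theorem Gamma_div_factorial_le (n : ℕ) :
    Real.Gamma ((n + 1 : ℕ) + 3.5) / (n ! : ℝ) ≤ 24 * ((n + 4).choose 4 : ℝ) := by
  have h1 : Real.Gamma ((n + 1 : ℕ) + 3.5) ≤ ((n + 4)! : ℝ) := by
    rw [← Real.Gamma_nat_eq_factorial]
    have hn : (0 : ℝ) ≤ n := n.cast_nonneg
    refine Real.Gamma_strictMonoOn_Ici.monotoneOn (Set.mem_Ici.2 ?_) (Set.mem_Ici.2 ?_) ?_ <;>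
      push_cast <;> linarith
  have h2 : ((n + 4).choose 4 : ℝ) * 24 * (n ! : ℝ) = ((n + 4)! : ℝ) := by
    have := Nat.add_choose_mul_factorial_mul_factorial n 4
    have h4 : (4)! = 24 := rfl
    rw [h4] at this
    rw [← this]
    push_cast
    ring
  rw [div_le_iff₀ (by positivity)]
  linarith

-- The base `3.5 + x` exceeds `1`, so the surplus exponent `-4.5` can be dropped, leaving the terms
-- of a negative binomial series.
theorem simplifiedLoadPMF_le {ψ x : ℝ} (hx0 : 0 < x)
    (hx : x = Real.pi * net.RB ^ 2 * net.lamU / ψ) (n : ℕ) :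
    simplifiedLoadPMF net ψ 1 (n + 1) ≤ (3.5 : ℝ) ^ (3.5 : ℝ) / Real.Gamma 3.5 * 24 *
      (((n + 4).choose 4 : ℝ) * (x / (3.5 + x)) ^ n) := by
  have hG := Real.Gamma_pos_of_pos (show (0 : ℝ) < 3.5 by norm_num)
  have h1 := Gamma_div_factorial_le n
  have h2 : (3.5 + x) ^ (-((n + 1 : ℕ) : ℝ) - 3.5) ≤ ((3.5 + x) ^ n)⁻¹ := by
    rw [← Real.rpow_natCast, ← Real.rpow_neg (by positivity)]
    refine Real.rpow_le_rpow_of_exponent_le (by linarith) ?_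
    push_cast
    linarith
  rw [simplifiedLoadPMF, if_neg (by simp), Nat.cast_one, one_mul, ← hx, Nat.add_sub_cancel]
  calc _ = (3.5 : ℝ) ^ (3.5 : ℝ) / Real.Gamma 3.5 *
        (Real.Gamma ((n + 1 : ℕ) + 3.5) / (n ! : ℝ)) *
          (x ^ n * (3.5 + x) ^ (-((n + 1 : ℕ) : ℝ) - 3.5)) := by
        field_simp
    _ ≤ (3.5 : ℝ) ^ (3.5 : ℝ) / Real.Gamma 3.5 * (24 * ((n + 4).choose 4 : ℝ)) *
          (x ^ n * ((3.5 + x) ^ n)⁻¹) := by gcongr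
    _ = _ := by rw [div_pow]; ring

/-- With `r = x / (3.5 + x)`, the dominating series sums to `(1 - r)⁻¹ ^ 5 = (1 + x / 3.5) ^ 5`, and
`x` is largest at `ψ = 1`. Exact normalization is not needed. -/
theorem exists_isBoundedLoad_simplifiedLoadPMF :
    ∃ K, IsBoundedLoad (fun ψ => simplifiedLoadPMF net ψ 1) K := by
  have hR := net.RB_pos
  have hU := net.lamU_pos
  have hpi := Real.pi_pos
  have hG := Real.Gamma_pos_of_pos (show (0 : ℝ) < 3.5 by norm_num)
  have hz : ∀ ψ, simplifiedLoadPMF net ψ 1 0 = 0 := fun ψ => by simp [simplifiedLoadPMF]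
  have hpos : ∀ ψ, 1 ≤ ψ → ∀ n, 0 < simplifiedLoadPMF net ψ 1 (n + 1) := fun ψ hψ n =>
    simplifiedLoadPMF_pos net (by linarith) one_pos n
  set A := (3.5 : ℝ) ^ (3.5 : ℝ) / Real.Gamma 3.5 * 24
  have hA0 : 0 < A := by positivity
  have hbound : ∀ ψ, 1 ≤ ψ → Summable (fun n => simplifiedLoadPMF net ψ 1 (n + 1)) ∧
      ∑' n, simplifiedLoadPMF net ψ 1 (n + 1) ≤
        A * (1 + Real.pi * net.RB ^ 2 * net.lamU) ^ 5 := by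
    intro ψ hψ
    obtain ⟨x, hx⟩ : ∃ x, x = Real.pi * net.RB ^ 2 * net.lamU / ψ := ⟨_, rfl⟩
    have hx0 : 0 < x := by rw [hx]; positivity
    have hx1 : x ≤ Real.pi * net.RB ^ 2 * net.lamU := by
      rw [hx]; exact div_le_self (by positivity) hψ
    have hr : ‖x / (3.5 + x)‖ < 1 := by
      rw [Real.norm_of_nonneg (by positivity), div_lt_one (by positivity)]
      linarith
    have hsum := (hasSum_choose_mul_geometric_of_norm_lt_one 4 hr).mul_left A
    have hle := simplifiedLoadPMF_le net hx0 hx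
    have hs := hsum.summable.of_nonneg_of_le (fun n => (hpos ψ hψ n).le) hle
    refine ⟨hs, (hs.tsum_le_tsum hle hsum.summable).trans ?_⟩
    rw [hsum.tsum_eq, ← one_div_pow]
    have h1 : 1 / (1 - x / (3.5 + x)) = 1 + x / 3.5 := by
      rw [one_sub_div (by positivity)]
      field_simp
      ring
    rw [h1]
    have h2 : x / 3.5 ≤ Real.pi * net.RB ^ 2 * net.lamU :=
      (div_le_self hx0.le (by norm_num)).trans hx1
    gcongr
  refine ⟨A * (1 + Real.pi * net.RB ^ 2 * net.lamU) ^ 5, fun ψ hψ n => ?_,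
    fun ψ _ => hz ψ, hpos 1 le_rfl 0,
    fun ψ hψ => (summable_nat_add_iff 1).1 (hbound ψ hψ).1, fun ψ hψ => ?_⟩
  · cases n with
    | zero => exact (hz ψ).ge
    | succ n => exact (hpos ψ hψ n).le
  · rw [((summable_nat_add_iff 1).1 (hbound ψ hψ).1).tsum_eq_zero_add, hz, zero_add]
    exact (hbound ψ hψ).2

end Load

end MmWave

/-! ### The densification gain -/

open MmWave in
theorem lemma3 (net : Params) (ρ₀ : ℝ) (hρ₀ : 0 < ρ₀)
    {Ω : ℝ → Type*} [∀ ψ, MeasurableSpace (Ω ψ)]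
    (P : ∀ ψ, Measure (Ω ψ)) [∀ ψ, IsProbabilityMeasure (P ψ)]
    (N : ∀ ψ, Deployment (Ω ψ))
    (hN : ∀ ψ, 0 < ψ → (N ψ).IsNetwork net ψ 1 (P ψ))
    (load : ℝ → ℕ → ℕ → ℝ) (hload : load = loadPMF net ∨ load = simplifiedLoadPMF net) :
    0 < (N 1).throughput net (P 1) (load 1 1) ρ₀ ∧
      ∃ a : ℝ, ∀ᶠ ψ in atTop, densificationGain net P N load ρ₀ ψ 1 ≤ a := by
  obtain ⟨K, hK⟩ : ∃ K, IsBoundedLoad (fun ψ => load ψ 1) K := by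
    rcases hload with rfl | rfl
    · exact ⟨1, isBoundedLoad_loadPMF net⟩
    · exact exists_isBoundedLoad_simplifiedLoadPMF net
  have hpos : 0 < (N 1).throughput net (P 1) (load 1 1) ρ₀ :=
    Deployment.throughput_pos (hN 1 one_pos) one_pos (hK.nonneg 1 le_rfl)
      (hK.summable 1 le_rfl) hK.one_pos hρ₀
  -- The constant corresponds to `ψ` times coverage being at most `1`, which holds eventually
  -- because that product tends to `0`.
  refine ⟨hpos, net.lamU * ρ₀ * K / (N 1).throughput net (P 1) (load 1 1) ρ₀, ?_⟩
  have hev := (tendsto_mul_coverage_bound net hρ₀).eventually (gt_mem_nhds one_pos)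
  filter_upwards [hev, eventually_ge_atTop 1] with ψ hψ h1
  have hψ0 : 0 < ψ := by linarith
  have hB := net.B_pos
  have hτ : 0 < (2 : ℝ) ^ (ψ * ρ₀ / net.B) - 1 :=
    sub_pos.2 (Real.one_lt_rpow one_lt_two (by positivity))
  have hcov := (hN ψ hψ0).coverage_le hψ0 hτ
  have hle := Deployment.throughput_le (N := N ψ) (net := net) (P := P ψ) (hK.nonneg ψ h1)
    (hK.zero ψ h1) (hK.summable ψ h1) (mul_pos hψ0 hρ₀)
  have hK0 : 0 ≤ K := (tsum_nonneg (hK.nonneg ψ h1)).trans (hK.tsum_le ψ h1)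
  have hU := net.lamU_pos
  refine div_le_div_of_nonneg_right (hle.trans ?_) hpos.le
  have hψcov := (mul_le_mul_of_nonneg_left hcov hψ0.le).trans hψ.le
  have hc0 := Deployment.coverage_nonneg (N := N ψ) (net := net) (P := P ψ)
    ((2 : ℝ) ^ (ψ * ρ₀ / net.B) - 1)
  calc _ ≤ net.lamU * (ψ * ρ₀) *
        (K * (N ψ).coverage net (P ψ) ((2 : ℝ) ^ (ψ * ρ₀ / net.B) - 1)) := by
        gcongr
        exact hK.tsum_le ψ h1
    _ = net.lamU * ρ₀ * K *
        (ψ * (N ψ).coverage net (P ψ) ((2 : ℝ) ^ (ψ * ρ₀ / net.B) - 1)) := by ring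
    _ ≤ net.lamU * ρ₀ * K * 1 := by gcongr
    _ = _ := mul_one _
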